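/- Let $\mathbb T$ be the unit circle with normalized Lebesgue measure $m$, $L^2=L^2(\mathbb T,m)$, and let $H^2\subset L^2$ be the Hardy space; for $f\in H^2$ let $f(0)$ be the value at the origin of its holomorphic extension to the disc. For an inner function $\theta$ put $K^2_\theta=H^2\ominus\theta H^2$, let $P_\theta$ be the orthogonal projection of $L^2$ onto $K^2_\theta$, and put $C_\theta f=\theta\,\overline{zf}$ for $f\in L^2$, $k_0^\theta=P_\theta 1=1-\overline{\theta(0)}\theta$ and $\tilde k_0^\theta=C_\theta k_0^\theta\in K^2_\theta$. Let $\alpha,\theta$ be nonconstant inner functions such that $\alpha$ divides $\theta$, i.e. $\frac\theta\alpha=\bar\alpha\theta$ is inner. For $\varphi\in L^2$ the operator $A^{\theta,\alpha}_\varphi f=P_\alpha(\varphi f)$ is defined for those $f\in K^2_\theta$ with $\varphi f\in L^2$; if it is bounded, its unique bounded extension $K^2_\theta\to K^2_\alpha$ is denoted by the same symbol, and $\mathcal T(\theta,\alpha)$ is the set of all bounded operators obtained in this way. Let $A\in\mathcal T(\theta,\alpha)$, with adjoint $A^*$. Consider the scalar linear system for $a,b,c\in\mathbb C$ $$a+\overline{\theta(0)}\,\alpha(0)\,b+\|k_0^\alpha\|^2c=\langle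 Ak_0^\theta,k_0^\alpha\rangle,\qquad \tfrac\theta\alpha(0)\,a+b=\langle A\tilde k_0^\theta,\tilde k_0^\alpha\rangle .\tag{1}$$ For every prescribed value of $a$ (this will be the value $\psi(0)$) the system (1) has exactly one solution $(a,b,c)$, and likewise for every prescribed value of $c$ (this will be the value $\overline{\chi(0)}$). Let $(a,b,c)$ be any solution of (1), and suppose that $X,Y,Z\in L^2$ satisfy, almost everywhere on $\mathbb T$, the linear system $$\begin{aligned} X-\overline{\theta(0)}\,Y&=Ak_0^\theta-c\,k_0^\alpha-b\,\overline{\theta(0)}\,\alpha,\\ -\theta(0)\,X+Y&=z\,A\tilde k_0^\theta-\tfrac\theta\alpha(0)\,a\,\alpha,\\ -\alpha(0)\tfrac\theta\alpha\,X+Y+(\alpha-\alpha(0))\,Z&=z\,C_\theta A^*k_0^\alpha-a\,\theta . \end{aligned}\tag{2}$$ Put $\psi=X$ and $\chi=\frac\theta\alpha\bar Z+\theta\bar Y$. Then $\psi\in K^2_\alpha$, $\chi\in K^2_\theta$, $\psi(0)=a$, $\chi(0)=\bar c$, and $A=A^{\theta,\alpha}_{\psi+\bar\chi}$. -/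

import Mathlib

open MeasureTheory AddCircle
open scoped ComplexConjugate ENNReal

noncomputable section

namespace ATTO

/-- The unit circle, parametrized as `ℝ / 2πℤ` by `t ↦ exp (i t)`. -/
abbrev Circ : Type := AddCircle (2 * Real.pi)

instance : Fact (0 < 2 * Real.pi) := ⟨Real.two_pi_pos⟩

/-- Normalized Lebesgue measure on the unit circle. -/
abbrev m : Measure Circ := haarAddCircle

/-- The Hilbert space of square integrable functions on the unit circle. -/
abbrev L2 : Type := Lp ℂ 2 m

/-- The space of essentially bounded functions on the unit circle. -/
abbrev Linf : Type := Lp ℂ ∞ m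

/-- The operator of multiplication by a bounded function `u`, acting on `L2`. -/
def mulOp (u : Linf) : L2 →L[ℂ] L2 := (ContinuousLinearMap.mul ℂ ℂ).holderL m ∞ 2 2 u

/-- The independent variable `z`, as a bounded function on the circle. -/
def zvar : Linf := fourierLp ∞ 1

/-- The constant function `1` in `L2`. -/
def one : L2 := fourierLp 2 0

/-- A bounded function regarded as an element of `L2`. -/
def toL2 (u : Linf) : L2 := mulOp u one

/-- The Hardy space `H²`, identified with the closed subspace of `L2` of those functions whose
Fourier coefficients of negative index vanish. -/
def H2 : Submodule ℂ L2 where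
  carrier := {f | ∀ n : ℤ, n < 0 → fourierCoeff f n = 0}
  zero_mem' := by
    intro n _
    rw [← fourierBasis_repr]
    simp
  add_mem' := by
    intro f g hf hg n hn
    have h1 := hf n hn
    have h2 := hg n hn
    rw [← fourierBasis_repr] at h1 h2 ⊢
    simp [h1, h2]
  smul_mem' := by
    intro c f hf n hn
    have h1 := hf n hn
    rw [← fourierBasis_repr] at h1 ⊢
    simp [h1]

/-- The value at the origin of (the holomorphic extension to the disc of) a function in `H²` or
in `H^∞`, that is, its Fourier coefficient of index `0`. -/
def at0 (f : Circ → ℂ) : ℂ := fourierCoeff f 0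

/-- Inner functions (given by their boundary values): bounded analytic functions that are
unimodular almost everywhere on the circle. -/
def IsInner (u : Linf) : Prop :=
  (∀ᵐ t ∂m, ‖u t‖ = 1) ∧ toL2 u ∈ H2

/-- `u` is not (almost everywhere equal to) a constant. -/
def Nonconstant (u : Linf) : Prop := ∀ c : ℂ, ¬ (∀ᵐ t ∂m, u t = c)

/-- The quotient `θ / α = conj α * θ` of two inner functions. -/
def quot (θ α : Linf) : Linf := (star α) • θ

/-- `α` divides `θ`, written `α ≤ θ`. -/
def Divides (α θ : Linf) : Prop := IsInner (quot θ α)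

/-- The model space `K²_θ = H² ⊖ θ H²`. -/
def K (θ : Linf) : Submodule ℂ L2 := H2 ⊓ (H2.map (mulOp θ).toLinearMap)ᗮ

lemma isClosed_H2 : IsClosed (H2 : Set L2) := by
  have h : (H2 : Set L2) = ⋂ n : ℤ, ⋂ _ : n < 0, {f : L2 | inner ℂ (fourierLp 2 n) f = 0} := by
    ext f
    simp only [Set.mem_iInter, Set.mem_ofPred_eq]
    refine forall_congr' fun n => forall_congr' fun _ => ?_
    rw [← fourierBasis_repr, fourierBasis.repr_apply_apply, coe_fourierBasis]
  rw [h]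
  refine isClosed_iInter fun n => isClosed_iInter fun _ => ?_
  exact isClosed_eq (by fun_prop) continuous_const

instance (θ : Linf) : CompleteSpace (K θ) := by
  have h : IsClosed (K θ : Set L2) :=
    isClosed_H2.inter (Submodule.isClosed_orthogonal _)
  exact h.completeSpace_coe

/-- The orthogonal projection `P_θ` of `L2` onto the model space `K²_θ`. -/
def P (θ : Linf) : L2 →L[ℂ] K θ := (K θ).orthogonalProjectionOnto

/-- The conjugation `C_θ f = θ * conj (z f)` on `L2`. -/
def C (θ : Linf) (f : L2) : L2 := mulOp θ (star (mulOp zvar f))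

/-- The kernel function `k_0^θ = P_θ 1` of the model space at the origin. -/
def k0 (θ : Linf) : K θ := P θ one

lemma coeFn_mulOp (u : Linf) (f : L2) : mulOp u f =ᵐ[m] fun t => u t * f t :=
  (ContinuousLinearMap.mul ℂ ℂ).coeFn_holder (r := 2) u f

lemma coeFn_C (θ : Linf) (f : L2) :
    C θ f =ᵐ[m] fun t => θ t * conj (fourier 1 t * f t) := by
  filter_upwards [coeFn_mulOp θ (star (mulOp zvar f)), Lp.coeFn_star (mulOp zvar f),
    coeFn_mulOp zvar f, coeFn_fourierLp (T := 2 * Real.pi) ∞ 1] with t h1 h2 h3 h4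
  rw [C, h1, h2, Pi.star_apply, h3, zvar, h4]
  rfl

lemma mem_H2_iff (f : L2) : f ∈ H2 ↔ ∀ n : ℤ, n < 0 → inner ℂ (fourierLp 2 n : L2) f = 0 := by
  refine forall_congr' fun n => forall_congr' fun _ => ?_
  rw [← fourierBasis_repr, fourierBasis.repr_apply_apply, coe_fourierBasis]

lemma fourier_mem_H2 {n : ℤ} (hn : 0 ≤ n) : (fourierLp 2 n : L2) ∈ H2 := by
  rw [mem_H2_iff]
  intro k hk
  exact orthonormal_fourier.2 (by omega)

/-- The conjugation `C_θ` preserves the model space `K²_θ`. -/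
lemma C_mem {θ : Linf} (hθ : IsInner θ) {f : L2} (hf : f ∈ K θ) : C θ f ∈ K θ := by
  obtain ⟨hf1, hf2⟩ := hf
  rw [SetLike.mem_coe, mem_H2_iff] at hf1
  rw [SetLike.mem_coe, Submodule.mem_orthogonal'] at hf2
  refine ⟨?_, ?_⟩
  · rw [SetLike.mem_coe, mem_H2_iff]
    intro n hn
    rw [← hf2 _ (Submodule.mem_map_of_mem (fourier_mem_H2 (n := -n - 1) (by omega))),
      L2.inner_def, L2.inner_def]
    refine integral_congr_ae ?_
    filter_upwards [coeFn_C θ f, coeFn_mulOp θ (fourierLp 2 (-n - 1)),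
      coeFn_fourierLp (T := 2 * Real.pi) 2 n, coeFn_fourierLp (T := 2 * Real.pi) 2 (-n - 1)]
      with t h1 h2 h3 h4
    rw [ContinuousLinearMap.coe_coe, h2, h1, h3, h4]
    have e : fourier (-n - 1) t = conj (fourier n t) * conj (fourier 1 t) := by
      rw [← fourier_neg, ← fourier_neg, ← fourier_add]
      rfl
    simp only [RCLike.inner_apply, e, map_mul]
    ring
  · rw [SetLike.mem_coe, Submodule.mem_orthogonal]
    rintro _ ⟨h, hh, rfl⟩
    rw [SetLike.mem_coe, mem_H2_iff] at hh
    have key : inner ℂ h (star (mulOp zvar f)) = 0 := by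
      rw [← (fourierBasis (T := 2 * Real.pi)).tsum_inner_mul_inner h (star (mulOp zvar f))]
      refine (tsum_congr fun n => ?_).trans tsum_zero
      rw [coe_fourierBasis]
      rcases lt_or_ge n 0 with hn | hn
      · rw [← inner_conj_symm, hh n hn]
        simp
      · have h0 := hf1 (-n - 1) (by omega)
        have : inner ℂ (fourierLp 2 n : L2) (star (mulOp zvar f)) =
            conj (inner ℂ (fourierLp 2 (-n - 1) : L2) f) := by
          rw [L2.inner_def, L2.inner_def, ← integral_conj]
          refine integral_congr_ae ?_
          filter_upwards [Lp.coeFn_star (mulOp zvar f), coeFn_mulOp zvar f,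
            coeFn_fourierLp (T := 2 * Real.pi) ∞ 1, coeFn_fourierLp (T := 2 * Real.pi) 2 n,
            coeFn_fourierLp (T := 2 * Real.pi) 2 (-n - 1)] with t h1 h2 h3 h4 h5
          rw [h1, Pi.star_apply, h2, zvar, h3, h4, h5]
          have e : fourier (-n - 1) t = conj (fourier n t) * conj (fourier 1 t) := by
            rw [← fourier_neg, ← fourier_neg, ← fourier_add]
            rfl
          simp only [RCLike.inner_apply, e, map_mul, RCLike.star_def, RCLike.conj_conj]
          ring
        rw [this, h0]
        simp
    rw [← key, L2.inner_def, L2.inner_def]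
    refine integral_congr_ae ?_
    filter_upwards [hθ.1, coeFn_mulOp θ h, coeFn_mulOp θ (star (mulOp zvar f))] with t h1 h2 h3
    rw [C, ContinuousLinearMap.coe_coe, h2, h3]
    have e : θ t * conj (θ t) = 1 := by
      rw [Complex.mul_conj, Complex.normSq_eq_norm_sq, h1]
      simp
    simp only [RCLike.inner_apply, map_mul]
    linear_combination (star (mulOp zvar f) : L2) t * conj (h t) * e

/-- The function `k̃_0^θ = C_θ k_0^θ`, an element of the model space. -/
def k0tilde {θ : Linf} (hθ : IsInner θ) : K θ := ⟨C θ (k0 θ), C_mem hθ (k0 θ).2⟩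

/-- The bounded operator `A : K²_θ → K²_α` is the (bounded extension of the) asymmetric truncated
Toeplitz operator `A_φ^{θ,α} f = P_α (φ f)` with symbol `φ ∈ L²`, whose domain consists of the
`f ∈ K²_θ` with `φ f ∈ L²`. -/
def HasSymbol {θ α : Linf} (A : K θ →L[ℂ] K α) (φ : L2) : Prop :=
  ∀ f : K θ, ∀ h : MemLp (fun t => φ t * (f : L2) t) 2 m, A f = P α (h.toLp _)

/-- The space `𝒯(θ, α)` of bounded asymmetric truncated Toeplitz operators. -/
def Toep (θ α : Linf) : Set (K θ →L[ℂ] K α) := {A | ∃ φ : L2, HasSymbol A φ}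

/-- The scalar linear system for `a`, `b`, `c`, whose right-hand sides are
`⟨A k_0^θ, k_0^α⟩` and `⟨A k̃_0^θ, k̃_0^α⟩` (Mathlib's inner product is linear in the second
variable). -/
def ScalarSystem {θ α : Linf} (hθ : IsInner θ) (hα : IsInner α) (A : K θ →L[ℂ] K α)
    (a b c : ℂ) : Prop :=
  a + conj (at0 θ) * at0 α * b + (‖k0 α‖ : ℂ) ^ 2 * c = inner ℂ (k0 α) (A (k0 θ)) ∧
  at0 (quot θ α) * a + b = inner ℂ (k0tilde hα) (A (k0tilde hθ))

/-- The functional linear system for `X`, `Y`, `Z`, an identity in `L2` in each row. -/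
def FunctionalSystem {θ α : Linf} (hθ : IsInner θ) (A : K θ →L[ℂ] K α)
    (a b c : ℂ) (X Y Z : L2) : Prop :=
  X - conj (at0 θ) • Y
      = (A (k0 θ) : L2) - c • (k0 α : L2) - (b * conj (at0 θ)) • toL2 α ∧
  -(at0 θ) • X + Y
      = mulOp zvar (A (k0tilde hθ) : L2) - (at0 (quot θ α) * a) • toL2 α ∧
  -(at0 α) • mulOp (quot θ α) X + Y + (mulOp α Z - at0 α • Z)
      = mulOp zvar (C θ (ContinuousLinearMap.adjoint A (k0 α) : L2)) - a • toL2 θ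

end ATTO

end

noncomputable section

namespace ATTO

open Filter

/-! The given `X`, `Y`, `Z` are never examined directly. A solution of both systems is built from a
symbol of `A`, and uniqueness of solutions forces the given data to coincide with it.

Existence of a good symbol: any L² symbol splits into an analytic and an antianalytic part, and
modulo `αH² + conj (θH²)`, which acts as zero, it becomes `ψ + conj χ` with `ψ ∈ K α`, `χ ∈ K θ`. A
constant can be moved between the two parts, so `ψ(0)` may be made equal to the given `a`
(`exists_normalized_symbol`).

From symbol to systems: write `C_θ χ = G + αh` with `G = P_α C_θ χ`, `h ∈ H²`, and put `Y = zG`, `Z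
= zh`, so that `θ conj χ = Y + αZ`. Projecting the symbol times each kernel function gives `A
k_0^θ`, `A k̃_0^θ` and `A* k_0^α` in terms of `ψ`, `χ`, `G`, `h`; these formulas are the rows of
both systems (`exists_solution`).

Uniqueness: since `|θ(0)|, |α(0)| < 1`, the number `a` determines `b` and `c`, and then the
functional system determines `X`, `Y`, `Z` in L² (`FunctionalSystem.unique`). Conjugating `θ conj χ
= Y + αZ` recovers `χ`.

Two devices keep this elementary. Pointwise identities are proved in the commutative ring of germs,
from `z conj z = 1` and `θ conj θ = 1`. Symbols are tested on bounded functions only, where products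
with L² symbols stay in L²; density and the adjoint then give the full domain. -/

/-! ### Germs modulo null sets. -/

/-- The ring of measurable-function germs in which pointwise identities are checked. -/
abbrev AEGerm : Type := Germ (ae m) ℂ

/-- The almost everywhere class of an `Lp` function, as an element of a commutative ring. -/
def germ {p : ℝ≥0∞} (f : Lp ℂ p m) : AEGerm := ((f : Circ → ℂ) : AEGerm)

/-- Pointwise complex conjugation of germs. -/
def gconj : AEGerm →+* AEGerm where
  toFun := Germ.map conj
  map_one' := congrArg (Germ.ofFun (l := ae m)) (funext fun _ => map_one (starRingEnd ℂ))
  map_zero' := congrArg (Germ.ofFun (l := ae m)) (funext fun _ => map_zero (starRingEnd ℂ))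
  map_mul' := by
    rintro ⟨f⟩ ⟨g⟩
    exact congrArg (Germ.ofFun (l := ae m)) (funext fun _ => map_mul (starRingEnd ℂ) _ _)
  map_add' := by
    rintro ⟨f⟩ ⟨g⟩
    exact congrArg (Germ.ofFun (l := ae m)) (funext fun _ => map_add (starRingEnd ℂ) _ _)

/-- Constant germs. -/
def gconst : ℂ →+* AEGerm where
  toFun c := Germ.ofFun fun _ => c
  map_one' := rfl
  map_zero' := rfl
  map_mul' _ _ := rfl
  map_add' _ _ := rfl

lemma gconj_gconj (x : AEGerm) : gconj (gconj x) = x := by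
  rcases x with ⟨f⟩
  exact congrArg (Germ.ofFun (l := ae m)) (funext fun _ => Complex.conj_conj _)

lemma gconj_gconst (c : ℂ) : gconj (gconst c) = gconst (conj c) := rfl

variable {p : ℝ≥0∞}

lemma germ_injective {f g : Lp ℂ p m} (h : germ f = germ g) : f = g :=
  Lp.ext (Germ.coe_eq.1 h)

lemma germ_add (f g : Lp ℂ p m) : germ (f + g) = germ f + germ g :=
  Germ.coe_eq.2 (Lp.coeFn_add f g)

lemma germ_sub (f g : Lp ℂ p m) : germ (f - g) = germ f - germ g :=
  Germ.coe_eq.2 (Lp.coeFn_sub f g)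

lemma germ_zero : germ (0 : Lp ℂ p m) = 0 :=
  Germ.coe_eq.2 (Lp.coeFn_zero ℂ p m)

lemma germ_smul (c : ℂ) (f : Lp ℂ p m) : germ (c • f) = gconst c * germ f :=
  Germ.coe_eq.2 (Lp.coeFn_smul c f)

lemma germ_star (f : Lp ℂ p m) : germ (star f) = gconj (germ f) :=
  Germ.coe_eq.2 (Lp.coeFn_star f)

lemma germ_mulOp (u : Linf) (f : L2) : germ (mulOp u f) = germ u * germ f :=
  Germ.coe_eq.2 (coeFn_mulOp u f)

lemma germ_lpSMul (u v : Linf) : germ (u • v : Linf) = germ u * germ v :=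
  Germ.coe_eq.2 (Lp.coeFn_lpSMul u v)

lemma germ_quot (θ α : Linf) : germ (quot θ α) = gconj (germ α) * germ θ := by
  rw [quot, germ_lpSMul, germ_star]

lemma germ_fourierLp [Fact (1 ≤ p)] (n : ℤ) :
    germ (fourierLp p n : Lp ℂ p m) = Germ.ofFun fun t : Circ => (fourier n t : ℂ) :=
  Germ.coe_eq.2 (coeFn_fourierLp p n)

lemma germ_one : germ one = 1 := by
  rw [one, germ_fourierLp]
  exact congrArg (Germ.ofFun (l := ae m)) (funext fun _ => fourier_zero)

lemma germ_toL2 (u : Linf) : germ (toL2 u) = germ u := by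
  rw [toL2, germ_mulOp, germ_one, mul_one]

lemma germ_C (θ : Linf) (f : L2) : germ (C θ f) = germ θ * (gconj (germ zvar) * gconj (germ f)) := by
  rw [C, germ_mulOp, germ_star, germ_mulOp, map_mul]

lemma germ_fourierLp_add (n k : ℤ) :
    germ (fourierLp 2 (n + k) : L2) =
      germ (fourierLp 2 n : L2) * germ (fourierLp 2 k : L2) := by
  simp only [germ_fourierLp]
  exact congrArg (Germ.ofFun (l := ae m)) (funext fun _ => fourier_add)

lemma germ_fourierLp_neg (n : ℤ) :
    germ (fourierLp 2 (-n) : L2) = gconj (germ (fourierLp 2 n : L2)) := by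
  simp only [germ_fourierLp]
  exact congrArg (Germ.ofFun (l := ae m)) (funext fun _ => fourier_neg)

lemma germ_zvar : germ zvar = germ (fourierLp 2 1 : L2) := by
  rw [zvar, germ_fourierLp, germ_fourierLp]

lemma germ_zvar_mul : germ zvar * gconj (germ zvar) = 1 := by
  rw [germ_zvar, ← germ_fourierLp_neg, ← germ_fourierLp_add, ← germ_one]
  rfl

lemma IsInner.germ_mul {θ : Linf} (hθ : IsInner θ) : germ θ * gconj (germ θ) = 1 := by
  refine Germ.coe_eq.2 ?_
  filter_upwards [hθ.1] with t ht
  change θ t * conj (θ t) = 1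
  rw [Complex.mul_conj, Complex.normSq_eq_norm_sq, ht]
  simp

/-- The inner product depends only on the germ of the integrand. -/
lemma inner_eq_of_germ {f g f' g' : L2}
    (h : gconj (germ f) * germ g = gconj (germ f') * germ g') : inner ℂ f g = inner ℂ f' g' := by
  rw [L2.inner_def, L2.inner_def]
  refine integral_congr_ae ?_
  filter_upwards [Germ.coe_eq.1 h] with t ht
  simp only [RCLike.inner_apply]
  rw [mul_comm, mul_comm (g' t)]
  exact ht

lemma inner_eq_conj_of_germ {f g f' g' : L2}
    (h : gconj (germ f) * germ g = germ f' * gconj (germ g')) :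
    inner ℂ f g = conj (inner ℂ f' g') := by
  rw [inner_conj_symm]
  exact inner_eq_of_germ (by rw [h, mul_comm])

lemma inner_mulOp_left (u : Linf) (f g : L2) :
    inner ℂ (mulOp u f) g = inner ℂ f (mulOp (star u) g) :=
  inner_eq_of_germ (by simp only [germ_mulOp, germ_star, map_mul]; ring)

lemma inner_mulOp_right (u : Linf) (f g : L2) :
    inner ℂ f (mulOp u g) = inner ℂ (mulOp (star u) f) g :=
  inner_eq_of_germ (by simp only [germ_mulOp, germ_star, map_mul, gconj_gconj]; ring)

/-! ### Fourier coefficients, the Hardy space and its orthogonal complement. -/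

lemma at0_eq_inner (f : L2) : at0 f = inner ℂ one f := by
  rw [at0, ← fourierBasis_repr, fourierBasis.repr_apply_apply, coe_fourierBasis, one]

lemma at0_eq_of_germ {f : Linf} {g : L2} (h : germ f = germ g) : at0 f = at0 g := by
  rw [at0, at0, fourierCoeff, fourierCoeff]
  refine integral_congr_ae ?_
  filter_upwards [Germ.coe_eq.1 h] with t ht
  rw [ht]

lemma at0_toL2 (u : Linf) : at0 u = inner ℂ one (toL2 u) := by
  rw [← at0_eq_inner]
  exact at0_eq_of_germ (germ_toL2 u).symm

lemma inner_one_one : inner ℂ one one = 1 := by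
  rw [one, orthonormal_iff_ite.1 orthonormal_fourier]
  simp

lemma eq_zero_of_inner_fourier {f : L2} (h : ∀ n : ℤ, inner ℂ (fourierLp 2 n : L2) f = 0) :
    f = 0 := by
  have : inner ℂ f f = 0 := by
    rw [← (fourierBasis (T := 2 * Real.pi)).tsum_inner_mul_inner f f]
    refine (tsum_congr fun n => ?_).trans tsum_zero
    rw [coe_fourierBasis, h n, mul_zero]
  exact inner_self_eq_zero.1 this

lemma one_mem_H2 : one ∈ H2 := fourier_mem_H2 le_rfl

lemma mem_H2_orthogonal_iff (f : L2) :
    f ∈ H2ᗮ ↔ ∀ n : ℤ, 0 ≤ n → inner ℂ (fourierLp 2 n : L2) f = 0 := by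
  rw [Submodule.mem_orthogonal]
  refine ⟨fun h n hn => h _ (fourier_mem_H2 hn), fun h g hg => ?_⟩
  rw [← (fourierBasis (T := 2 * Real.pi)).tsum_inner_mul_inner g f]
  refine (tsum_congr fun n => ?_).trans tsum_zero
  rw [coe_fourierBasis]
  rcases lt_or_ge n 0 with hn | hn
  · rw [← inner_conj_symm, (mem_H2_iff g).1 hg n hn]
    simp
  · rw [h n hn, mul_zero]

lemma inner_fourier_zmul (n : ℤ) (f : L2) :
    inner ℂ (fourierLp 2 (n + 1) : L2) (mulOp zvar f) = inner ℂ (fourierLp 2 n : L2) f :=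
  inner_eq_of_germ (by
    rw [germ_mulOp, germ_fourierLp_add, map_mul, ← germ_zvar]
    linear_combination gconj (germ (fourierLp 2 n : L2)) * germ f * germ_zvar_mul)

lemma inner_fourier_star (n : ℤ) (f : L2) :
    inner ℂ (fourierLp 2 (-n) : L2) (star f) = conj (inner ℂ (fourierLp 2 n : L2) f) :=
  inner_eq_conj_of_germ (by
    rw [germ_fourierLp_neg, germ_star, gconj_gconj])

lemma zmul_mem_H2 {f : L2} (hf : f ∈ H2) : mulOp zvar f ∈ H2 := by
  rw [mem_H2_iff] at hf ⊢
  intro n hn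
  rw [← sub_add_cancel n 1, inner_fourier_zmul]
  exact hf _ (by omega)

lemma zmul_zbar (f : L2) : mulOp zvar (mulOp (star zvar) f) = f :=
  germ_injective (by
    simp only [germ_mulOp, germ_star]
    linear_combination germ f * germ_zvar_mul)

lemma inner_fourier_zbar (n : ℤ) (f : L2) :
    inner ℂ (fourierLp 2 n : L2) (mulOp (star zvar) f) =
      inner ℂ (fourierLp 2 (n + 1) : L2) f := by
  rw [← inner_fourier_zmul, zmul_zbar]

lemma zbar_mem_H2_orthogonal {f : L2} (hf : f ∈ H2ᗮ) : mulOp (star zvar) f ∈ H2ᗮ := by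
  rw [mem_H2_orthogonal_iff] at hf ⊢
  intro n hn
  rw [inner_fourier_zbar]
  exact hf _ (by omega)

lemma zbar_mem_H2 {f : L2} (hf : f ∈ H2) (h0 : inner ℂ one f = 0) :
    mulOp (star zvar) f ∈ H2 := by
  rw [mem_H2_iff] at hf ⊢
  intro n hn
  rw [inner_fourier_zbar]
  rcases eq_or_lt_of_le (show n + 1 ≤ 0 by omega) with h | h
  · rw [h]
    exact h0
  · exact hf _ h

lemma star_mem_H2_of_orthogonal {f : L2} (hf : f ∈ H2ᗮ) : star f ∈ H2 := by
  rw [mem_H2_iff]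
  rw [mem_H2_orthogonal_iff] at hf
  intro n hn
  rw [← neg_neg n, inner_fourier_star, hf _ (by omega), map_zero]

lemma star_mem_H2_orthogonal {f : L2} (hf : f ∈ H2) (h0 : inner ℂ one f = 0) : star f ∈ H2ᗮ := by
  rw [mem_H2_orthogonal_iff]
  rw [mem_H2_iff] at hf
  intro n hn
  rw [← neg_neg n, inner_fourier_star]
  rcases eq_or_lt_of_le (show -n ≤ 0 by omega) with h | h
  · rw [h]
    exact (congrArg conj h0).trans (map_zero _)
  · rw [hf _ h, map_zero]

lemma inner_one_zmul {f : L2} (hf : f ∈ H2) : inner ℂ one (mulOp zvar f) = 0 := by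
  have h := inner_fourier_zmul (-1) f
  rw [(mem_H2_iff f).1 hf (-1) (by norm_num)] at h
  exact h

/-- The function is `conj (zf)`, and `zf` vanishes at the origin, so only negative frequencies
survive conjugation. -/
lemma zbar_star_mem_H2_orthogonal {f : L2} (hf : f ∈ H2) :
    mulOp (star zvar) (star f) ∈ H2ᗮ := by
  have h := star_mem_H2_orthogonal (zmul_mem_H2 hf) (inner_one_zmul hf)
  convert h using 1
  exact germ_injective (by simp only [germ_mulOp, germ_star, map_mul])

lemma sub_at0_mem {f : L2} (hf : f ∈ H2) (c : ℂ) (hc : inner ℂ one f = c) :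
    f - c • one ∈ H2 ∧ inner ℂ one (f - c • one) = 0 := by
  refine ⟨H2.sub_mem hf (H2.smul_mem _ one_mem_H2), ?_⟩
  rw [inner_sub_right, inner_smul_right, inner_one_one, hc]
  ring

lemma zmul_sub_mem_H2_orthogonal {f : L2} (hf : f ∈ H2ᗮ) :
    mulOp zvar f - inner ℂ one (mulOp zvar f) • one ∈ H2ᗮ := by
  rw [mem_H2_orthogonal_iff] at hf ⊢
  intro n hn
  rw [inner_sub_right, inner_smul_right]
  rcases eq_or_lt_of_le hn with rfl | h
  · change inner ℂ one _ - _ * inner ℂ one one = 0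
    rw [inner_one_one]
    ring
  · rw [one, orthonormal_fourier.2 (by omega : n ≠ 0), ← sub_add_cancel n 1, inner_fourier_zmul,
      hf _ (by omega)]
    ring

/-- By duality: for `n < 0` the function `conj u · zⁿ` has only negative frequencies, hence is
orthogonal to `f`. -/
lemma mulOp_mem_H2 {u : Linf} (hu : toL2 u ∈ H2) {f : L2} (hf : f ∈ H2) : mulOp u f ∈ H2 := by
  rw [mem_H2_iff]
  intro n hn
  rw [inner_mulOp_right]
  have key : mulOp (star u) (fourierLp 2 n : L2) ∈ H2ᗮ := by
    rw [mem_H2_orthogonal_iff]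
    intro k hk
    have : inner ℂ (fourierLp 2 k : L2) (mulOp (star u) (fourierLp 2 n : L2)) =
        conj (inner ℂ (fourierLp 2 (-k + n) : L2) (toL2 u)) := inner_eq_conj_of_germ (by
      rw [germ_fourierLp_add, germ_fourierLp_neg, germ_toL2, germ_mulOp, germ_star]
      ring)
    rw [this, (mem_H2_iff _).1 hu _ (by omega), map_zero]
  exact Submodule.inner_left_of_mem_orthogonal hf key

/-- Evaluation at the origin is multiplicative: with `f = f(0) + zg`, the term `zug` has mean zero.
-/
lemma inner_one_mulOp {u : Linf} (hu : toL2 u ∈ H2) {f : L2} (hf : f ∈ H2) :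
    inner ℂ one (mulOp u f) = at0 u * inner ℂ one f := by
  obtain ⟨h1, h2⟩ := sub_at0_mem hf _ rfl
  set g := mulOp (star zvar) (f - inner ℂ one f • one) with hg
  have h3 : mulOp u f = inner ℂ one f • toL2 u + mulOp zvar (mulOp u g) := germ_injective (by
    rw [hg]
    simp only [germ_mulOp, germ_star, germ_add, germ_sub, germ_smul, germ_toL2, germ_one]
    linear_combination
      -germ u * (germ f - gconst (inner ℂ one f)) * germ_zvar_mul)
  rw [h3, inner_add_right, inner_smul_right, inner_one_zmul (mulOp_mem_H2 hu (zbar_mem_H2 h1 h2)),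
    at0_toL2]
  ring

/-! ### Model spaces and their projections. -/

lemma mem_K_iff {θ : Linf} {f : L2} : f ∈ K θ ↔ f ∈ H2 ∧ mulOp (star θ) f ∈ H2ᗮ := by
  refine and_congr Iff.rfl ?_
  rw [SetLike.mem_coe, Submodule.mem_orthogonal, Submodule.mem_orthogonal]
  refine ⟨fun h g hg => ?_, fun h g hg => ?_⟩
  · rw [← inner_mulOp_left]
    exact h _ (Submodule.mem_map_of_mem hg)
  · obtain ⟨k, hk, rfl⟩ := hg
    exact (inner_mulOp_left θ k f).trans (h k hk)

lemma inner_mulOp_of_mem_K {θ : Linf} {f h : L2} (hf : f ∈ K θ) (hh : h ∈ H2) :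
    inner ℂ (mulOp θ h) f = 0 := by
  rw [inner_mulOp_left]
  exact Submodule.inner_right_of_mem_orthogonal hh (mem_K_iff.1 hf).2

lemma inner_toL2_of_mem_K {θ : Linf} {f : L2} (hf : f ∈ K θ) : inner ℂ (toL2 θ) f = 0 :=
  inner_mulOp_of_mem_K hf one_mem_H2

/-- The projection onto the model space, read off from a decomposition of the function. -/
lemma P_eq {θ : Linf} {f g h n : L2} (hf : f = g + mulOp θ h + n) (hg : g ∈ K θ) (hh : h ∈ H2)
    (hn : n ∈ H2ᗮ) : P θ f = ⟨g, hg⟩ := by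
  refine Subtype.ext (Submodule.eq_starProjection_of_mem_of_inner_eq_zero hg fun w hw => ?_)
  rw [hf, add_assoc, add_sub_cancel_left, inner_add_left, inner_mulOp_of_mem_K hw hh,
    Submodule.inner_left_of_mem_orthogonal (mem_K_iff.1 hw).1 hn, add_zero]

lemma exists_H2_decomp (f : L2) : ∃ g ∈ H2, ∃ n ∈ H2ᗮ, f = g + n := by
  have : CompleteSpace H2 := isClosed_H2.completeSpace_coe
  exact Submodule.exists_add_mem_mem_orthogonal f

/-- Every function in `H²` splits along `H² = K²_θ ⊕ θ H²`. -/
lemma exists_K_decomp {θ : Linf} (hθ : IsInner θ) {f : L2} (hf : f ∈ H2) :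
    ∃ h ∈ H2, f = (P θ f : L2) + mulOp θ h := by
  -- The quotient `h` is the analytic part of `conj θ · f`; what remains of `f` is then `θn`, whose
  -- product with `conj θ` is antianalytic.
  obtain ⟨h, hh, n, hn, e⟩ := exists_H2_decomp (mulOp (star θ) f)
  have hg : f - mulOp θ h ∈ K θ := by
    refine mem_K_iff.2 ⟨H2.sub_mem hf (mulOp_mem_H2 hθ.2 hh), ?_⟩
    convert hn using 1
    have e' := congrArg germ e
    refine germ_injective ?_
    simp only [germ_mulOp, germ_star, germ_add, germ_sub] at e' ⊢
    linear_combination e' - germ h * hθ.germ_mul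
  refine ⟨h, hh, ?_⟩
  rw [P_eq (f := f) (g := f - mulOp θ h) (n := 0) (by abel) hg hh (Submodule.zero_mem _)]
  exact (sub_add_cancel _ _).symm

lemma inner_P (θ : Linf) (f : L2) {g : L2} (hg : g ∈ K θ) :
    inner ℂ g (P θ f : L2) = inner ℂ g f := by
  have h := Submodule.inner_orthogonalProjectionOnto_eq_of_mem_left (K := K θ) ⟨g, hg⟩ f
  exact h

lemma inner_P_left (θ : Linf) (f : L2) {g : L2} (hg : g ∈ K θ) :
    inner ℂ (P θ f : L2) g = inner ℂ f g := by
  rw [← inner_conj_symm, inner_P θ f hg, inner_conj_symm]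

/-! ### Kernel functions, shifts and density of bounded functions. -/

/-- The bounded representative of the kernel function at the origin. -/
def kerBdd (θ : Linf) : Linf := fourierLp ∞ 0 - conj (at0 θ) • θ

lemma germ_kerBdd (θ : Linf) : germ (kerBdd θ) = 1 - gconst (conj (at0 θ)) * germ θ := by
  rw [kerBdd, germ_sub, germ_smul, ← germ_one, one, germ_fourierLp, germ_fourierLp]

/-- The bounded representative of the conjugate kernel function at the origin. -/
def conjKerBdd (θ : Linf) : Linf := (star zvar • (θ - at0 θ • fourierLp ∞ 0 : Linf) : Linf)

lemma germ_conjKerBdd (θ : Linf) :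
    germ (conjKerBdd θ) = gconj (germ zvar) * (germ θ - gconst (at0 θ)) := by
  have h : germ (fourierLp ∞ 0 : Linf) = 1 := by
    rw [← germ_one, one, germ_fourierLp, germ_fourierLp]
  rw [conjKerBdd, germ_lpSMul, germ_sub, germ_smul, germ_star, h, mul_one]

lemma kerBdd_mem {θ : Linf} (hθ : IsInner θ) : toL2 (kerBdd θ) ∈ K θ := by
  have e : toL2 (kerBdd θ) = one - conj (at0 θ) • toL2 θ := germ_injective (by
    simp only [germ_toL2, germ_kerBdd, germ_sub, germ_one, germ_smul])
  refine mem_K_iff.2 ⟨?_, ?_⟩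
  · rw [e]
    exact H2.sub_mem one_mem_H2 (H2.smul_mem _ hθ.2)
  · obtain ⟨h1, h2⟩ := sub_at0_mem hθ.2 (at0 θ) (at0_toL2 θ).symm
    convert star_mem_H2_orthogonal h1 h2 using 1
    refine germ_injective ?_
    simp only [germ_mulOp, germ_star, germ_toL2, germ_kerBdd, germ_sub, germ_one, germ_smul,
      map_sub, map_mul, gconj_gconst, map_one]
    linear_combination -gconst (conj (at0 θ)) * hθ.germ_mul

lemma k0_eq {θ : Linf} (hθ : IsInner θ) : k0 θ = ⟨toL2 (kerBdd θ), kerBdd_mem hθ⟩ := by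
  refine P_eq (h := conj (at0 θ) • one) (n := 0) (germ_injective ?_) _
    (H2.smul_mem _ one_mem_H2) (Submodule.zero_mem _)
  simp only [germ_toL2, germ_kerBdd, germ_add, germ_mulOp, germ_one, germ_smul, germ_zero]
  ring

lemma k0tilde_coe {θ : Linf} (hθ : IsInner θ) :
    (k0tilde hθ : L2) = toL2 (conjKerBdd θ) := by
  change C θ (k0 θ) = _
  rw [k0_eq hθ]
  refine germ_injective ?_
  simp only [germ_C, germ_toL2, germ_kerBdd, germ_conjKerBdd, map_sub, map_mul, gconj_gconst,
    Complex.conj_conj, map_one]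
  linear_combination -gconj (germ zvar) * gconst (at0 θ) * hθ.germ_mul

lemma conjKerBdd_mem {θ : Linf} (hθ : IsInner θ) : toL2 (conjKerBdd θ) ∈ K θ := by
  rw [← k0tilde_coe hθ]
  exact (k0tilde hθ).2

/-- The backward shift preserves the model space. -/
lemma backward_shift_mem {θ : Linf} (hθ : IsInner θ) {f : L2} (hf : f ∈ K θ) :
    mulOp (star zvar) (f - at0 f • one) ∈ K θ := by
  obtain ⟨h1, h2⟩ := mem_K_iff.1 hf
  obtain ⟨h3, h4⟩ := sub_at0_mem h1 (at0 f) (at0_eq_inner f).symm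
  refine mem_K_iff.2 ⟨zbar_mem_H2 h3 h4, ?_⟩
  convert Submodule.sub_mem _ (zbar_mem_H2_orthogonal h2)
    (Submodule.smul_mem _ (at0 f) (zbar_star_mem_H2_orthogonal hθ.2)) using 1
  refine germ_injective ?_
  simp only [germ_toL2, germ_mulOp, germ_star, germ_sub, germ_one, germ_smul]
  ring

/-- The compressed shift of an element of the model space. -/
lemma compressed_shift_mem {θ : Linf} (hθ : IsInner θ) {g : L2} (hg : g ∈ K θ) :
    mulOp zvar g - inner ℂ (toL2 θ) (mulOp zvar g) • toL2 θ ∈ K θ := by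
  obtain ⟨h1, h2⟩ := mem_K_iff.1 hg
  refine mem_K_iff.2 ⟨H2.sub_mem (zmul_mem_H2 h1) (H2.smul_mem _ hθ.2), ?_⟩
  -- Multiplication by `z` moves frequency -1 of `conj θ · g` to frequency 0; the subtracted
  -- multiple of `θ` removes exactly this mean.
  convert zmul_sub_mem_H2_orthogonal h2 using 1
  have e : inner ℂ (toL2 θ) (mulOp zvar g) = inner ℂ one (mulOp zvar (mulOp (star θ) g)) :=
    inner_eq_of_germ (by simp only [germ_toL2, germ_mulOp, germ_star, germ_one, map_one]; ring)
  rw [e]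
  refine germ_injective ?_
  simp only [germ_toL2, germ_mulOp, germ_star, germ_sub, germ_one, germ_smul]
  linear_combination
    -gconst (inner ℂ one (mulOp zvar (mulOp (star θ) g))) * hθ.germ_mul

/-- The model-space part of `zⁿ` is bounded, by iterating the compressed shift: `z(u + θh) = (zu -
cθ) + θ(zh + c)`. -/
lemma exists_bdd_decomp_fourier {θ : Linf} (hθ : IsInner θ) (n : ℕ) :
    ∃ u : Linf, toL2 u ∈ K θ ∧ ∃ h ∈ H2, (fourierLp 2 (n : ℤ) : L2) = toL2 u + mulOp θ h := by
  induction n with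
  | zero =>
    refine ⟨kerBdd θ, kerBdd_mem hθ, conj (at0 θ) • one, H2.smul_mem _ one_mem_H2, ?_⟩
    refine germ_injective ?_
    rw [Nat.cast_zero, ← one]
    simp only [germ_toL2, germ_kerBdd, germ_add, germ_mulOp, germ_one, germ_smul]
    ring
  | succ n ih =>
    obtain ⟨u, hu, h, hh, e⟩ := ih
    set c := inner ℂ (toL2 θ) (mulOp zvar (toL2 u))
    have e1 : toL2 ((zvar • u : Linf) - c • θ) = mulOp zvar (toL2 u) - c • toL2 θ :=
      germ_injective (by
        simp only [germ_toL2, germ_lpSMul, germ_sub, germ_mulOp, germ_smul])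
    refine ⟨(zvar • u : Linf) - c • θ, e1 ▸ compressed_shift_mem hθ hu, mulOp zvar h + c • one,
      H2.add_mem (zmul_mem_H2 hh) (H2.smul_mem _ one_mem_H2), germ_injective ?_⟩
    have e2 := congrArg germ e
    rw [e1, Nat.cast_succ, germ_fourierLp_add, ← germ_zvar]
    simp only [germ_toL2, germ_add, germ_sub, germ_mulOp, germ_one, germ_smul] at e2 ⊢
    linear_combination germ zvar * e2

/-- The bounded functions are dense in the model space. -/
lemma eq_of_inner_bdd {θ : Linf} (hθ : IsInner θ) {f g : K θ}
    (h : ∀ u : Linf, toL2 u ∈ K θ → inner ℂ (toL2 u) (f : L2) = inner ℂ (toL2 u) (g : L2)) :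
    f = g := by
  rw [← sub_eq_zero]
  have hm := (f - g).2
  refine Subtype.ext (eq_zero_of_inner_fourier fun n => ?_)
  rcases lt_or_ge n 0 with hn | hn
  · exact (mem_H2_iff _).1 (mem_K_iff.1 hm).1 n hn
  · obtain ⟨k, rfl⟩ := Int.eq_ofNat_of_zero_le hn
    obtain ⟨u, hu, w, hw, e⟩ := exists_bdd_decomp_fourier hθ k
    rw [e, inner_add_left, inner_mulOp_of_mem_K hm hw, add_zero, Submodule.coe_sub,
      inner_sub_right, h u hu, sub_self]

/-! ### Values at the origin. -/

lemma IsInner.inner_self {θ : Linf} (hθ : IsInner θ) : inner ℂ (toL2 θ) (toL2 θ) = (1 : ℂ) := by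
  rw [← inner_one_one]
  refine inner_eq_of_germ ?_
  simp only [germ_toL2, germ_one, map_one]
  linear_combination hθ.germ_mul

/-- This number is `‖θ - θ(0)‖²`, so its vanishing would make `θ` constant. Every division in the
proof rests on it. -/
lemma one_sub_at0_ne_zero {θ : Linf} (hθ : IsInner θ) (hθ' : Nonconstant θ) :
    1 - conj (at0 θ) * at0 θ ≠ 0 := by
  intro h
  have h2 : inner ℂ (toL2 θ - at0 θ • one) (toL2 θ - at0 θ • one) = (0 : ℂ) := by
    rw [inner_sub_left, inner_sub_right, inner_sub_right, inner_smul_left, inner_smul_left,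
      inner_smul_right, inner_smul_right, ← inner_conj_symm (toL2 θ) one, ← at0_toL2,
      inner_one_one, hθ.inner_self]
    linear_combination h
  have h3 := congrArg germ (inner_self_eq_zero.1 h2)
  rw [germ_sub, germ_toL2, germ_smul, germ_one, germ_zero, mul_one, sub_eq_zero] at h3
  exact hθ' _ (Filter.Germ.coe_eq.1 h3)

lemma inner_one_k0 {θ : Linf} (hθ : IsInner θ) :
    inner ℂ one (k0 θ : L2) = 1 - conj (at0 θ) * at0 θ := by
  have e : (k0 θ : L2) = one - conj (at0 θ) • toL2 θ := by
    rw [k0_eq hθ]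
    exact germ_injective (by
      simp only [germ_toL2, germ_kerBdd, germ_sub, germ_one, germ_smul])
  rw [e, inner_sub_right, inner_smul_right, inner_one_one, at0_toL2]

lemma norm_sq_k0 {θ : Linf} (hθ : IsInner θ) :
    (‖k0 θ‖ : ℂ) ^ 2 = 1 - conj (at0 θ) * at0 θ := by
  rw [← inner_one_k0 hθ, ← inner_P_left θ one (k0 θ).2]
  exact (inner_self_eq_norm_sq_to_K (k0 θ : L2)).symm

lemma inner_k0 (θ : Linf) (f : K θ) : inner ℂ (k0 θ) f = inner ℂ one (f : L2) :=
  inner_P_left θ one f.2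

lemma germ_mul_quot {θ α : Linf} (hα : IsInner α) : germ α * germ (quot θ α) = germ θ := by
  rw [germ_quot]
  linear_combination germ θ * hα.germ_mul

lemma at0_eq_mul_quot {θ α : Linf} (hα : IsInner α) (hdiv : Divides α θ) :
    at0 θ = at0 α * at0 (quot θ α) := by
  rw [at0_toL2 (quot θ α), ← inner_one_mulOp hα.2 hdiv.2, ← at0_eq_inner]
  exact at0_eq_of_germ (by rw [germ_mulOp, germ_toL2, germ_mul_quot hα])

/-! ### Symbols tested on bounded functions. -/

/-- `A` acts on the bounded functions of the model space as the operator with symbol `σ`. -/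
def HasSymbolOnBdd {θ α : Linf} (A : K θ →L[ℂ] K α) (σ : L2) : Prop :=
  ∀ (u : Linf) (hu : toL2 u ∈ K θ), A ⟨toL2 u, hu⟩ = P α (mulOp u σ)

lemma HasSymbol.onBdd {θ α : Linf} {A : K θ →L[ℂ] K α} {φ : L2} (h : HasSymbol A φ) :
    HasSymbolOnBdd A φ := by
  intro u hu
  have e : (fun t => φ t * (toL2 u : L2) t) =ᵐ[m] mulOp u φ := by
    have h1 : germ (mulOp u φ) = germ φ * germ (toL2 u) := by
      rw [germ_mulOp, germ_toL2, mul_comm]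
    exact (Filter.Germ.coe_eq.1 h1).symm
  rw [h ⟨toL2 u, hu⟩ ((memLp_congr_ae e).2 (Lp.memLp _))]
  exact congrArg (P α) (Lp.ext ((MemLp.coeFn_toLp _).trans e))

/-- Symbols in `α H² + conj (θ H²)` act as zero on bounded functions. -/
lemma P_mulOp_eq_zero {θ α : Linf} (hθ : IsInner θ) {u : Linf} (hu : toL2 u ∈ K θ)
    {h₁ h₂ : L2} (hh₁ : h₁ ∈ H2) (hh₂ : h₂ ∈ H2) :
    P α (mulOp u (mulOp α h₁ + star (mulOp θ h₂))) = 0 := by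
  -- This is `C_θ u`. It is bounded and analytic, and `u conj (θ h₂) = conj (z · C_θ u · h₂)` is
  -- therefore antianalytic.
  have hw : toL2 (θ • star (zvar • u : Linf) : Linf) ∈ H2 := by
    have h := (mem_K_iff.1 (C_mem hθ hu)).1
    convert h using 1
    exact germ_injective (by
      simp only [germ_toL2, germ_lpSMul, germ_C, germ_star, map_mul])
  have hu' := (mem_K_iff.1 hu).1
  refine P_eq (h := mulOp u h₁)
    (n := mulOp (star zvar) (star (mulOp (θ • star (zvar • u : Linf) : Linf) h₂)))
    (germ_injective ?_) (Submodule.zero_mem _) (mulOp_mem_H2 hu' hh₁)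
    (zbar_star_mem_H2_orthogonal (mulOp_mem_H2 hw hh₂))
  simp only [germ_mulOp, germ_add, germ_star, germ_lpSMul, germ_zero, map_mul, gconj_gconj]
  linear_combination -germ u * gconj (germ θ) * gconj (germ h₂) * germ_zvar_mul

/-- A bounded asymmetric truncated Toeplitz operator has a symbol `ψ + conj χ` with `ψ` and `χ`
in the model spaces and a prescribed value of `ψ` at the origin. -/
lemma exists_normalized_symbol {θ α : Linf} (hθ : IsInner θ) (hα : IsInner α)
    (hα' : Nonconstant α) {A : K θ →L[ℂ] K α} (hA : A ∈ Toep θ α) (a : ℂ) :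
    ∃ ψ ∈ K α, ∃ χ ∈ K θ, at0 ψ = a ∧ HasSymbolOnBdd A (ψ + star χ) := by
  obtain ⟨φ, hφ⟩ := hA
  obtain ⟨f, hf, n, hn, e⟩ := exists_H2_decomp φ
  -- Adding `s` to the analytic part changes the value of its projection at the origin by `s ·
  -- k_0^α(0) = s(1 - |α(0)|²)`.
  set s : ℂ := (a - inner ℂ one (P α f : L2)) / (1 - conj (at0 α) * at0 α) with hs
  obtain ⟨h₁, hh₁, e₁⟩ := exists_K_decomp hα (H2.add_mem hf (H2.smul_mem s one_mem_H2))
  obtain ⟨h₂, hh₂, e₂⟩ := exists_K_decomp hθ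
    (H2.sub_mem (star_mem_H2_of_orthogonal hn) (H2.smul_mem (conj s) one_mem_H2))
  refine ⟨_, (P α (f + s • one)).2, _, (P θ (star n - conj s • one)).2, ?_, fun u hu => ?_⟩
  · have h1 : (P α (f + s • one) : L2) = (P α f : L2) + s • (k0 α : L2) := by
      rw [map_add, map_smul, k0]
      rfl
    rw [at0_eq_inner, h1, inner_add_right, inner_smul_right, inner_one_k0 hα, hs,
      div_mul_cancel₀ _ (one_sub_at0_ne_zero hα hα')]
    ring
  · rw [hφ.onBdd u hu]
    set p : L2 := (P α (f + s • one)).1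
    set q : L2 := (P θ (star n - conj s • one)).1
    have e' : φ = (p + star q) + (mulOp α h₁ + star (mulOp θ h₂)) := by
      have g := congrArg germ e
      have g₁ := congrArg germ e₁
      have g₂ := congrArg gconj (congrArg germ e₂)
      refine germ_injective ?_
      simp only [germ_add, germ_sub, germ_smul, germ_star, germ_mulOp, germ_one, map_add, map_sub,
        map_mul, gconj_gconj, gconj_gconst, Complex.conj_conj, map_one] at g g₁ g₂ ⊢
      linear_combination g + g₁ + g₂
    rw [e', map_add, map_add, P_mulOp_eq_zero hθ hu hh₁ hh₂, add_zero]

lemma HasSymbolOnBdd.adjoint {θ α : Linf} (hθ : IsInner θ) {A : K θ →L[ℂ] K α} {σ : L2}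
    (h : HasSymbolOnBdd A σ) : HasSymbolOnBdd (ContinuousLinearMap.adjoint A) (star σ) := by
  intro u hu
  refine eq_of_inner_bdd hθ fun v hv => ?_
  have h1 := ContinuousLinearMap.adjoint_inner_right A ⟨toL2 v, hv⟩ ⟨toL2 u, hu⟩
  rw [inner_P θ _ hv]
  refine h1.trans ?_
  rw [h v hv]
  refine (inner_P_left α _ hu).trans (inner_eq_of_germ ?_)
  simp only [germ_mulOp, germ_toL2, germ_star, map_mul]
  ring

/-- Pairing `A f` with a bounded `u` and passing to the adjoint puts the symbol on `u`; no
approximation of `f` is needed. -/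
lemma HasSymbolOnBdd.hasSymbol {θ α : Linf} (hθ : IsInner θ) (hα : IsInner α)
    {A : K θ →L[ℂ] K α} {σ : L2} (h : HasSymbolOnBdd A σ) : HasSymbol A σ := by
  intro f hf
  refine eq_of_inner_bdd hα fun u hu => ?_
  have h1 := ContinuousLinearMap.adjoint_inner_left A f ⟨toL2 u, hu⟩
  rw [inner_P α _ hu]
  refine h1.symm.trans ?_
  rw [h.adjoint hθ u hu]
  refine (inner_P_left θ _ f.2).trans (inner_eq_of_germ ?_)
  have e : germ (hf.toLp _) = germ σ * germ (f : L2) :=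
    Filter.Germ.coe_eq.2 (MemLp.coeFn_toLp hf)
  simp only [germ_mulOp, germ_toL2, germ_star, map_mul, gconj_gconj, e]
  ring

/-! ### Solving the two systems, and uniqueness. -/

/-- A normalized symbol of `A` gives a solution of both linear systems. -/
lemma exists_solution {θ α : Linf} (hθ : IsInner θ) (hα : IsInner α) (hdiv : Divides α θ)
    {A : K θ →L[ℂ] K α} {ψ χ : L2} (hψ : ψ ∈ K α) (hχ : χ ∈ K θ)
    (hA : HasSymbolOnBdd A (ψ + star χ)) :
    ∃ (b : ℂ) (Y Z : L2), ScalarSystem hθ hα A (at0 ψ) b (conj (at0 χ)) ∧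
      FunctionalSystem hθ A (at0 ψ) b (conj (at0 χ)) ψ Y Z ∧
      mulOp θ (star χ) = Y + mulOp α Z := by
  have hψ1 := (mem_K_iff.1 hψ).1
  have hχ1 := (mem_K_iff.1 hχ).1
  obtain ⟨h, hh, ew⟩ := exists_K_decomp hα (mem_K_iff.1 (C_mem hθ hχ)).1
  have hG := (P α (C θ χ)).2
  set G : L2 := (P α (C θ χ)).1
  have hG1 := (mem_K_iff.1 hG).1
  -- The coefficient for which `zG - bα` lies in `K α`.
  set b : ℂ := inner ℂ (toL2 α) (mulOp zvar G) with hb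
  set a : ℂ := at0 ψ with ha
  set d : ℂ := at0 χ with hd
  set β : ℂ := at0 (quot θ α) with hβ
  have eα := hα.germ_mul
  have eθ := hθ.germ_mul
  have ez := germ_zvar_mul
  have eq := germ_mul_quot (θ := θ) hα
  have eq' := germ_quot θ α
  have e0 : gconst (at0 θ) = gconst (at0 α) * gconst β := by
    rw [at0_eq_mul_quot hα hdiv, map_mul]
  have e0' : gconst (conj (at0 θ)) = gconst (conj (at0 α)) * gconst (conj β) := by
    rw [at0_eq_mul_quot hα hdiv, map_mul, map_mul]
  replace ew := congrArg germ ew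
  rw [germ_add, germ_mulOp, germ_C] at ew
  have eF : germ θ * gconj (germ χ) = germ zvar * (germ G + germ α * germ h) := by
    linear_combination germ zvar * ew - germ θ * gconj (germ χ) * ez
  have eχ : germ χ = germ θ * gconj (germ zvar) *
      (gconj (germ G) + gconj (germ α) * gconj (germ h)) := by
    have := congrArg gconj ew
    simp only [map_mul, map_add, gconj_gconj] at this
    linear_combination germ θ * gconj (germ zvar) * this - germ χ * eθ -
      germ θ * gconj (germ θ) * germ χ * ez
  have hqψ : mulOp (quot θ α) ψ ∈ H2 := mulOp_mem_H2 hdiv.2 hψ1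
  have hqψ0 : inner ℂ one (mulOp (quot θ α) ψ) = β * a := by
    rw [inner_one_mulOp hdiv.2 hψ1, ha, at0_eq_inner ψ]
  obtain ⟨hq1, hq2⟩ := sub_at0_mem hqψ _ hqψ0
  have hk0 : (k0 α : L2) = toL2 (kerBdd α) := congrArg Subtype.val (k0_eq hα)
  -- the image of the kernel function
  have hχd := sub_at0_mem hχ1 d (by rw [hd, at0_eq_inner])
  have hψa := sub_at0_mem hψ1 a (by rw [ha, at0_eq_inner])
  have r1 : (A (k0 θ) : L2) = ψ + conj d • toL2 (kerBdd α) -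
      conj (at0 θ) • (mulOp zvar G - b • toL2 α) := by
    have hmem : ψ + conj d • toL2 (kerBdd α) -
        conj (at0 θ) • (mulOp zvar G - b • toL2 α) ∈ K α :=
      (K α).sub_mem ((K α).add_mem hψ ((K α).smul_mem _ (kerBdd_mem hα)))
        ((K α).smul_mem _ (compressed_shift_mem hα hG))
    rw [k0_eq hθ, hA _ (kerBdd_mem hθ)]
    refine congrArg Subtype.val (P_eq
      -- The `αH²` part collects the `α` left over from `conj d = conj d · (k_0^α + conj α(0) · α)`,
      -- the term `θψ = α · (θ/α)ψ`, and `bα` and `αzh` from `θ conj χ = zG + αzh`.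
      (h := (conj d * conj (at0 α)) • one - conj (at0 θ) • mulOp (quot θ α) ψ -
        (conj (at0 θ) * b) • one - conj (at0 θ) • mulOp zvar h)
      (n := star (χ - d • one)) (germ_injective ?_) hmem ?_ (star_mem_H2_orthogonal hχd.1 hχd.2))
    · simp only [germ_mulOp, germ_add, germ_sub, germ_smul, germ_star, germ_toL2, germ_kerBdd,
        germ_one, map_mul, map_sub, map_one, gconj_gconst]
      linear_combination gconst (conj (at0 θ)) * germ ψ * eq - gconst (conj (at0 θ)) * eF
    · exact H2.sub_mem (H2.sub_mem (H2.sub_mem (H2.smul_mem _ one_mem_H2) (H2.smul_mem _ hqψ))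
        (H2.smul_mem _ one_mem_H2)) (H2.smul_mem _ (zmul_mem_H2 hh))
  -- the image of the conjugate kernel function
  have r2 : (A (k0tilde hθ) : L2) = (β * a) • toL2 (conjKerBdd α) -
      at0 θ • mulOp (star zvar) (ψ - a • one) + G := by
    have hmem : (β * a) • toL2 (conjKerBdd α) -
        at0 θ • mulOp (star zvar) (ψ - a • one) + G ∈ K α :=
      (K α).add_mem ((K α).sub_mem ((K α).smul_mem _ (conjKerBdd_mem hα))
        ((K α).smul_mem _ (backward_shift_mem hα hψ))) hG
    have hk : k0tilde hθ = ⟨toL2 (conjKerBdd θ), conjKerBdd_mem hθ⟩ :=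
      Subtype.ext (k0tilde_coe hθ)
    rw [hk, hA _ (conjKerBdd_mem hθ)]
    refine congrArg Subtype.val (P_eq
      (h := mulOp (star zvar) (mulOp (quot θ α) ψ - (β * a) • one) + h)
      (n := -at0 θ • mulOp (star zvar) (star χ)) (germ_injective ?_) hmem
      (H2.add_mem (zbar_mem_H2 hq1 hq2) hh)
      (Submodule.smul_mem _ _ (zbar_star_mem_H2_orthogonal hχ1)))
    simp only [germ_mulOp, germ_add, germ_sub, germ_smul, germ_star, germ_toL2, germ_conjKerBdd,
      germ_one, map_mul, map_neg]
    linear_combination -gconj (germ zvar) * germ ψ * eq + ew - gconst a * gconj (germ zvar) * e0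
  -- the image of the kernel function under the adjoint
  have m1 : C θ h ∈ K θ := by
    refine mem_K_iff.2 ⟨?_, ?_⟩
    · convert H2.sub_mem (mulOp_mem_H2 hα.2 hχ1)
        (mulOp_mem_H2 hθ.2 (mem_K_iff.1 (C_mem hα hG)).1) using 1
      refine germ_injective ?_
      simp only [germ_mulOp, germ_sub, germ_C]
      linear_combination -germ α * eχ - germ θ * gconj (germ zvar) * gconj (germ h) * eα
    · convert zbar_star_mem_H2_orthogonal hh using 1
      refine germ_injective ?_
      simp only [germ_mulOp, germ_star, germ_C]
      linear_combination gconj (germ zvar) * gconj (germ h) * eθ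
  have m2 : mulOp α (star ψ) - conj (a * β) • toL2 θ ∈ K θ := by
    refine mem_K_iff.2 ⟨H2.sub_mem ?_ (H2.smul_mem _ hθ.2), ?_⟩
    · convert zmul_mem_H2 (mem_K_iff.1 (C_mem hα hψ)).1 using 1
      refine germ_injective ?_
      simp only [germ_mulOp, germ_star, germ_C]
      linear_combination -germ α * gconj (germ ψ) * ez
    · convert star_mem_H2_orthogonal hq1 hq2 using 1
      refine germ_injective ?_
      simp only [germ_mulOp, germ_star, germ_sub, germ_smul, germ_toL2, germ_one, eq', map_mul,
        map_sub, gconj_gconj, gconj_gconst, map_one]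
      linear_combination -gconst (conj a) * gconst (conj β) * eθ
  have r3 : (ContinuousLinearMap.adjoint A (k0 α) : L2) = conj a • toL2 (kerBdd θ) + χ -
      conj (at0 α) • (mulOp α (star ψ) - conj (a * β) • toL2 θ) - conj (at0 α) • C θ h := by
    have hmem : conj a • toL2 (kerBdd θ) + χ -
        conj (at0 α) • (mulOp α (star ψ) - conj (a * β) • toL2 θ) -
          conj (at0 α) • C θ h ∈ K θ :=
      (K θ).sub_mem ((K θ).sub_mem ((K θ).add_mem ((K θ).smul_mem _ (kerBdd_mem hθ)) hχ)
        ((K θ).smul_mem _ m2)) ((K θ).smul_mem _ m1)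
    rw [k0_eq hα, hA.adjoint hθ _ (kerBdd_mem hα)]
    refine congrArg Subtype.val (P_eq (h := -conj (at0 α) • C α G)
      (n := star (ψ - a • one)) (germ_injective ?_) hmem
      (H2.smul_mem _ (mem_K_iff.1 (C_mem hα hG)).1) (star_mem_H2_orthogonal hψa.1 hψa.2))
    simp only [germ_mulOp, germ_add, germ_sub, germ_smul, germ_star, germ_toL2, germ_kerBdd,
      germ_one, germ_C, map_mul, map_add, map_sub, map_neg, map_one, gconj_gconst, gconj_gconj]
    linear_combination -gconst (conj (at0 α)) * germ α * eχ
      - gconst (conj (at0 α)) * germ θ * gconj (germ zvar) * gconj (germ h) * eα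
      + gconst (conj a) * germ θ * e0'
  have f2 : -(at0 θ) • ψ + mulOp zvar G =
      mulOp zvar (A (k0tilde hθ) : L2) - (β * a) • toL2 α := by
    rw [r2]
    refine germ_injective ?_
    simp only [germ_mulOp, germ_add, germ_sub, germ_smul, germ_star, germ_toL2, germ_conjKerBdd,
      germ_one, map_mul, map_neg]
    linear_combination (gconst (at0 θ) * (germ ψ - gconst a)
      - gconst β * gconst a * (germ α - gconst (at0 α))) * ez - gconst a * e0
  refine ⟨b, mulOp zvar G, mulOp zvar h, ⟨?_, ?_⟩, ⟨?_, f2, ?_⟩, ?_⟩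
  · rw [inner_k0, r1, inner_sub_right, inner_add_right, inner_smul_right, inner_smul_right,
      inner_sub_right, inner_smul_right, inner_one_zmul hG1, ← hk0, inner_one_k0 hα, ← at0_toL2,
      norm_sq_k0 hα, ha, at0_eq_inner]
    ring
  · have hz : inner ℂ (k0tilde hα) (A (k0tilde hθ)) =
        inner ℂ (toL2 α - at0 α • one) (mulOp zvar (A (k0tilde hθ) : L2)) := by
      refine Eq.trans (b := inner ℂ (k0tilde hα : L2) (A (k0tilde hθ) : L2)) rfl ?_
      rw [k0tilde_coe hα]
      refine inner_eq_of_germ ?_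
      simp only [germ_toL2, germ_conjKerBdd, germ_sub, germ_mulOp, germ_smul, germ_one, map_mul,
        gconj_gconj, mul_one]
      ring
    -- Pairing the second functional row with `α` yields the second scalar equation: `ψ ⊥ α`, and
    -- `zG` contributes `b`.
    have hf := eq_add_of_sub_eq f2.symm
    rw [hz, inner_sub_left, inner_smul_left, inner_one_zmul (mem_K_iff.1 (A _).2).1, hf,
      inner_add_right, inner_add_right, inner_smul_right, inner_smul_right,
      inner_toL2_of_mem_K hψ, hα.inner_self, ← hb]
    ring
  · rw [r1, hk0]
    refine germ_injective ?_
    simp only [germ_mulOp, germ_add, germ_sub, germ_smul, germ_toL2, map_mul]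
    ring
  · rw [r3]
    refine germ_injective ?_
    simp only [germ_mulOp, germ_add, germ_sub, germ_smul, germ_star, germ_toL2, germ_kerBdd,
      germ_C, map_mul, map_add, map_sub, map_neg, map_one, gconj_gconst, gconj_gconj,
      Complex.conj_conj]
    linear_combination
      (-germ θ * (gconst a * (1 - gconst (at0 θ) * gconj (germ θ)) + gconj (germ χ)
        - gconst (at0 α) * (gconj (germ α) * germ ψ - gconst a * gconst β * gconj (germ θ))
        - gconst (at0 α) * (gconj (germ θ) * (germ zvar * germ h)))) * ez
      - gconst (at0 α) * germ ψ * eq' - eF + gconst a * germ θ * gconj (germ θ) * e0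
      + gconst (at0 α) * germ zvar * germ h * eθ
  · refine germ_injective ?_
    simp only [germ_mulOp, germ_add, germ_star]
    linear_combination eF

/-- The functional system has at most one solution. -/
lemma FunctionalSystem.unique {θ α : Linf} (hθ : IsInner θ) (hθ' : Nonconstant θ)
    (hα : IsInner α) (hα' : Nonconstant α) {A : K θ →L[ℂ] K α} {a b c : ℂ}
    {X Y Z X' Y' Z' : L2} (h : FunctionalSystem hθ A a b c X Y Z)
    (h' : FunctionalSystem hθ A a b c X' Y' Z') : X = X' ∧ Y = Y' ∧ Z = Z' := by
  obtain ⟨h1, h2, h3⟩ := h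
  obtain ⟨k1, k2, k3⟩ := h'
  rw [← k1] at h1
  rw [← k2] at h2
  rw [← k3] at h3
  have hY : Y = Y' := by
    have : (1 - conj (at0 θ) * at0 θ) • (Y - Y') = 0 := by
      have e1 := congrArg germ h1
      have e2 := congrArg germ h2
      refine germ_injective ?_
      simp only [germ_add, germ_sub, germ_smul, germ_zero, map_sub, map_mul, map_one, map_neg]
        at e1 e2 ⊢
      linear_combination gconst (at0 θ) * e1 + e2
    exact sub_eq_zero.1 ((smul_eq_zero.1 this).resolve_left (one_sub_at0_ne_zero hθ hθ'))
  subst hY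
  have hX : X = X' := sub_left_injective h1
  subst hX
  refine ⟨rfl, rfl, ?_⟩
  have e := add_left_cancel h3
  have e' : mulOp α (Z - Z') = at0 α • (Z - Z') := by
    rw [map_sub, smul_sub]
    exact sub_eq_sub_iff_sub_eq_sub.1 e
  -- Multiplication by `α` is isometric, but here it acts as the scalar `α(0)` of modulus less than
  -- 1.
  have hn : inner ℂ (mulOp α (Z - Z')) (mulOp α (Z - Z')) = inner ℂ (Z - Z') (Z - Z') := by
    refine inner_eq_of_germ ?_
    simp only [germ_mulOp, map_mul]
    linear_combination gconj (germ (Z - Z')) * germ (Z - Z') * hα.germ_mul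
  rw [e', inner_smul_left, inner_smul_right] at hn
  have h0 : (1 - conj (at0 α) * at0 α) * inner ℂ (Z - Z') (Z - Z') = 0 := by
    linear_combination -hn
  exact sub_eq_zero.1 (inner_self_eq_zero.1
    ((mul_eq_zero.1 h0).resolve_left (one_sub_at0_ne_zero hα hα')))

end ATTO

end

/-! ### The theorem. -/

theorem mainTheorem8 (α θ : ATTO.Linf)
    (hα : ATTO.IsInner α) (hα' : ATTO.Nonconstant α)
    (hθ : ATTO.IsInner θ) (hθ' : ATTO.Nonconstant θ)
    (hdiv : ATTO.Divides α θ)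
    (A : ATTO.K θ →L[ℂ] ATTO.K α) (hA : A ∈ ATTO.Toep θ α) :
    (∀ v : ℂ, ∃! p : ℂ × ℂ × ℂ, ATTO.ScalarSystem hθ hα A p.1 p.2.1 p.2.2 ∧ p.1 = v) ∧
    (∀ v : ℂ, ∃! p : ℂ × ℂ × ℂ, ATTO.ScalarSystem hθ hα A p.1 p.2.1 p.2.2 ∧ p.2.2 = conj v) ∧
    ∀ a b c : ℂ, ATTO.ScalarSystem hθ hα A a b c →
      ∀ X Y Z : ATTO.L2, ATTO.FunctionalSystem hθ A a b c X Y Z →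
        ∀ ψ χ : ATTO.L2, ψ = X →
          χ = ATTO.mulOp (ATTO.quot θ α) (star Z) + ATTO.mulOp θ (star Y) →
          ψ ∈ ATTO.K α ∧ χ ∈ ATTO.K θ ∧ ATTO.at0 ψ = a ∧ ATTO.at0 χ = conj c ∧
            ATTO.HasSymbol A (ψ + star χ) := by
  have nα := ATTO.one_sub_at0_ne_zero hα hα'
  have nθ := ATTO.one_sub_at0_ne_zero hθ hθ'
  have e0 := ATTO.at0_eq_mul_quot hα hdiv
  refine ⟨fun v => ?_, fun v => ?_, ?_⟩
  · simp only [ATTO.ScalarSystem, ATTO.norm_sq_k0 hα]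
    generalize (inner ℂ (ATTO.k0 α) (A (ATTO.k0 θ)) : ℂ) = r
    generalize (inner ℂ (ATTO.k0tilde hα) (A (ATTO.k0tilde hθ)) : ℂ) = s
    refine ⟨(v, s - ATTO.at0 (ATTO.quot θ α) * v,
      (r - v - conj (ATTO.at0 θ) * ATTO.at0 α * (s - ATTO.at0 (ATTO.quot θ α) * v)) /
        (1 - conj (ATTO.at0 α) * ATTO.at0 α)), ⟨⟨?_, ?_⟩, rfl⟩, ?_⟩
    · rw [mul_div_cancel₀ _ nα]
      ring
    · ring
    · rintro ⟨a, b, c⟩ ⟨⟨h1, h2⟩, rfl⟩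
      have hb : b = s - ATTO.at0 (ATTO.quot θ α) * a := by linear_combination h2
      subst hb
      refine Prod.ext rfl (Prod.ext rfl ?_)
      refine eq_div_of_mul_eq nα ?_
      linear_combination h1
  · simp only [ATTO.ScalarSystem, ATTO.norm_sq_k0 hα]
    generalize (inner ℂ (ATTO.k0 α) (A (ATTO.k0 θ)) : ℂ) = r
    generalize (inner ℂ (ATTO.k0tilde hα) (A (ATTO.k0tilde hθ)) : ℂ) = s
    set w := r - (1 - conj (ATTO.at0 α) * ATTO.at0 α) * conj v with hw
    -- Eliminating `b` leaves `a` with coefficient `1 - conj θ(0) · α(0) · (θ/α)(0)`, which is `1 -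
    -- |θ(0)|²` by `e0`.
    refine ⟨((w - conj (ATTO.at0 θ) * ATTO.at0 α * s) / (1 - conj (ATTO.at0 θ) * ATTO.at0 θ),
      s - ATTO.at0 (ATTO.quot θ α) * ((w - conj (ATTO.at0 θ) * ATTO.at0 α * s) /
        (1 - conj (ATTO.at0 θ) * ATTO.at0 θ)), conj v), ⟨⟨?_, ?_⟩, rfl⟩, ?_⟩
    · have h := div_mul_cancel₀ (w - conj (ATTO.at0 θ) * ATTO.at0 α * s) nθ
      linear_combination h + hw + (w - conj (ATTO.at0 θ) * ATTO.at0 α * s) /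
        (1 - conj (ATTO.at0 θ) * ATTO.at0 θ) * conj (ATTO.at0 θ) * e0
    · ring
    · rintro ⟨a, b, c⟩ ⟨⟨h1, h2⟩, h3⟩
      simp only at h1 h2 h3
      subst h3
      have ha : a = (w - conj (ATTO.at0 θ) * ATTO.at0 α * s) /
          (1 - conj (ATTO.at0 θ) * ATTO.at0 θ) := by
        refine eq_div_of_mul_eq nθ ?_
        linear_combination h1 - hw - conj (ATTO.at0 θ) * ATTO.at0 α * h2 -
          a * conj (ATTO.at0 θ) * e0
      refine Prod.ext ha (Prod.ext ?_ rfl)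
      rw [← ha]
      linear_combination h2
  · rintro a b c ⟨hs1, hs2⟩ X Y Z hF _ _ rfl rfl
    obtain ⟨ψ, hψ, χ, hχ, rfl, hB⟩ := ATTO.exists_normalized_symbol hθ hα hα' hA a
    obtain ⟨b', Y', Z', ⟨hS1, hS2⟩, hF', hd⟩ := ATTO.exists_solution hθ hα hdiv hψ hχ hB
    -- Both triples have the same first entry, so the scalar system identifies the other two.
    obtain rfl : b = b' := by linear_combination hs2 - hS2
    obtain rfl : c = conj (ATTO.at0 χ) := by
      rw [ATTO.norm_sq_k0 hα] at hs1 hS1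
      refine mul_left_cancel₀ nα ?_
      linear_combination hs1 - hS1
    obtain ⟨rfl, rfl, rfl⟩ := hF.unique hθ hθ' hα hα' hF'
    have hχe : ATTO.mulOp (ATTO.quot θ α) (star Z) + ATTO.mulOp θ (star Y) = χ := by
      have e := congrArg ATTO.gconj (congrArg ATTO.germ hd)
      refine ATTO.germ_injective ?_
      simp only [ATTO.germ_mulOp, ATTO.germ_add, ATTO.germ_star, ATTO.germ_quot, map_add, map_mul,
        ATTO.gconj_gconj] at e ⊢
      linear_combination -ATTO.germ θ * e + ATTO.germ χ * hθ.germ_mul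
    rw [hχe]
    exact ⟨hψ, hχ, rfl, (Complex.conj_conj _).symm, hB.hasSymbol hθ hα⟩
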